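/- Let $\boldsymbol x\sim\mathcal N(0,\Sigma_x)$ be a Gaussian random vector in $\mathbb R^p$ with $\Sigma_x\succ O$. There are $m$ senders $i\in[m]$ and a receiver $r$. Sender $i$ commits to a Borel measurable policy $\eta_i:\mathbb R^p\to\mathbb R^p$ and sends $\boldsymbol y_i=\eta_i(\boldsymbol x)$; the receiver then takes the action $\boldsymbol u=\gamma(\boldsymbol y_1,\dots,\boldsymbol y_m)\in\mathbb R^t$ with $\gamma$ Borel measurable. Each player $i\in\{1,\dots,m,r\}$ has the expected cost $J_i(\eta_1,\dots,\eta_m;\gamma)=\mathbb E\,\|Q_i\boldsymbol x+R_i\boldsymbol u\|^2$, where $Q_i\in\mathbb R^{q\times p}$, $R_i\in\mathbb R^{q\times t}$ and $R_r^\top R_r$ is invertible. For announced policies $\eta$ the receiver uses a best response $\gamma^*(\eta)$, i.e. a minimizer of $J_r(\eta;\cdot)$. The policies $(\eta_i^*)_{i\in[m]}$ are Nash equilibrium policies if $J_i(\eta^*;\gamma^*(\eta^*))\le J_i(\eta_i,\eta_{-i}^*;\gamma^*(\eta_i,\eta_{-i}^*))$ for every $i$ and every Borel measurable $\eta_i$.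 The posterior induced by $\eta$ is $\mathbb E[\hat{\boldsymbol x}\hat{\boldsymbol x}^\top]$ with $\hat{\boldsymbol x}=\mathbb E[\boldsymbol x\mid\boldsymbol y_1,\dots,\boldsymbol y_m]$. For $i\in[m]$ put $\Lambda_i=R_i(R_r^\top R_r)^{-1}R_r^\top Q_r$ and $V_i=\Lambda_i^\top\Lambda_i-\Lambda_i^\top Q_i-Q_i^\top\Lambda_i$. Let $k_1,\dots,k_m$ be any ordering of the senders, let $T_0=O$, and for $j=1,\dots,m$, with $i=k_j$: let $S_i$ be a minimizer of $\mathrm{Tr}(V_iS)$ over $\Sigma_x\succeq S\succeq T_{j-1}$, and let $T_j$ be a minimizer of the nuclear norm $\|\Sigma_x^{-1/2}S'\Sigma_x^{-1/2}\|_*$ over $\Sigma_x\succeq S'\succeq T_{j-1}$ with $\mathrm{Tr}(V_iS_i)\ge\mathrm{Tr}(V_iS')$. Let $\Sigma^*=T_m$ and $P'=\Sigma_x^{-1/2}\Sigma^*\Sigma_x^{-1/2}$. Then: 1. $\Sigma^*$ is stable for every sender: $\min_{\Sigma_x\succeq S\succeq\Sigma^*}\mathrm{Tr}(V_iS)=\mathrm{Tr}(V_i\Sigma^*)$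 for all $i\in[m]$. 2. $P'$ is an (orthogonal) projection matrix, and $\Sigma^*=\Sigma_x^{1/2}P'\Sigma_x^{1/2}$. 3. For every eigendecomposition $P'=U_{P'}\Lambda_{P'}U_{P'}^\top$ ($U_{P'}$ orthogonal, $\Lambda_{P'}$ diagonal), the common linear policy $\eta_i(\boldsymbol x)=L\boldsymbol x$, $i\in[m]$, with $L^\top=\Sigma_x^{-1/2}U_{P'}\Lambda_{P'}$, constitutes Nash equilibrium policies of the $m$-sender game, and it induces the posterior $\Sigma^*$. -/

import Mathlib

open MeasureTheory ProbabilityTheory Matrix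
open scoped MatrixOrder ENNReal

noncomputable section

namespace StrategicCommunication

/-! ### The game -/

/-- Signaling policies of the senders: sender `i` sends `η i x` when the state is `x`. -/
abbrev Policies (m p : ℕ) : Type :=
  Fin m → EuclideanSpace ℝ (Fin p) → EuclideanSpace ℝ (Fin p)

/-- Strategies of the receiver: an action in `ℝ^t` for every tuple of received signals. -/
abbrev Response (m p t : ℕ) : Type :=
  (Fin m → EuclideanSpace ℝ (Fin p)) → EuclideanSpace ℝ (Fin t)

section Game

variable {m p q t : ℕ} {Ω : Type*} [MeasurableSpace Ω]
  (P : Measure Ω) (x : Ω → EuclideanSpace ℝ (Fin p))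

/-- The tuple of signals received by the receiver. -/
def signals (η : Policies m p) (ω : Ω) : Fin m → EuclideanSpace ℝ (Fin p) :=
  fun i => η i (x ω)

/-- The expected quadratic cost `E ‖Q x + R u‖²`, where `u` is the action taken by the receiver.
It takes values in `[0, ∞]`, so that it is meaningful for every measurable strategy. -/
def expectedCost (Q : Matrix (Fin q) (Fin p) ℝ) (R : Matrix (Fin q) (Fin t) ℝ)
    (η : Policies m p) (γ : Response m p t) : ℝ≥0∞ :=
  ∫⁻ ω, ‖toEuclideanLin Q (x ω) + toEuclideanLin R (γ (signals x η ω))‖ₑ ^ 2 ∂P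

/-- `γ` minimizes the expected cost of the receiver among all Borel measurable strategies, when
the senders are committed to the policies `η`. -/
def IsBestResponse (Qr : Matrix (Fin q) (Fin p) ℝ) (Rr : Matrix (Fin q) (Fin t) ℝ)
    (η : Policies m p) (γ : Response m p t) : Prop :=
  Measurable γ ∧ ∀ γ' : Response m p t, Measurable γ' →
    expectedCost P x Qr Rr η γ ≤ expectedCost P x Qr Rr η γ'

/-- `γ` assigns to every tuple of Borel measurable sender policies a best response of the
receiver. -/
def IsBestResponseMap (Qr : Matrix (Fin q) (Fin p) ℝ) (Rr : Matrix (Fin q) (Fin t) ℝ)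
    (γ : Policies m p → Response m p t) : Prop :=
  ∀ η : Policies m p, (∀ i, Measurable (η i)) → IsBestResponse P x Qr Rr η (γ η)

/-- The policies `η` and the receiver's reaction rule `γ` form a (hierarchical) equilibrium:
the receiver responds optimally to all announced policies, and no sender can decrease its expected
cost by announcing another Borel measurable policy, the receiver reacting to the deviation. -/
def IsEquilibrium (Q : Fin m → Matrix (Fin q) (Fin p) ℝ) (R : Fin m → Matrix (Fin q) (Fin t) ℝ)
    (Qr : Matrix (Fin q) (Fin p) ℝ) (Rr : Matrix (Fin q) (Fin t) ℝ)
    (η : Policies m p) (γ : Policies m p → Response m p t) : Prop :=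
  (∀ i, Measurable (η i)) ∧ IsBestResponseMap P x Qr Rr γ ∧
    ∀ (i : Fin m) (η' : EuclideanSpace ℝ (Fin p) → EuclideanSpace ℝ (Fin p)), Measurable η' →
      expectedCost P x (Q i) (R i) η (γ η) ≤
        expectedCost P x (Q i) (R i) (Function.update η i η') (γ (Function.update η i η'))

/-- The policies `η` are Nash equilibrium policies: best response maps of the receiver exist, and
together with any of them `η` is an equilibrium. -/
def IsNashPolicies (Q : Fin m → Matrix (Fin q) (Fin p) ℝ) (R : Fin m → Matrix (Fin q) (Fin t) ℝ)
    (Qr : Matrix (Fin q) (Fin p) ℝ) (Rr : Matrix (Fin q) (Fin t) ℝ) (η : Policies m p) : Prop :=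
  (∃ γ : Policies m p → Response m p t, IsBestResponseMap P x Qr Rr γ) ∧
    ∀ γ : Policies m p → Response m p t, IsBestResponseMap P x Qr Rr γ →
      IsEquilibrium P x Q R Qr Rr η γ

/-- The receiver's posterior estimate `x̂ = E[x | y₁, …, yₘ]`. -/
def posteriorEstimate (η : Policies m p) : Ω → EuclideanSpace ℝ (Fin p) :=
  P[x | MeasurableSpace.comap (signals x η) inferInstance]

/-- The posterior covariance `E[x̂ x̂ᵀ]` induced by the policies `η` (for a centered state). -/
def posteriorCov (η : Policies m p) : Matrix (Fin p) (Fin p) ℝ :=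
  Matrix.of fun a b => ∫ ω, posteriorEstimate P x η ω a * posteriorEstimate P x η ω b ∂P

end Game

/-! ### The sequential semidefinite programs -/

section SDP

variable {m p q t : ℕ}

/-- The matrix `Λ = R (Rrᵀ Rr)⁻¹ Rrᵀ Qr` of a sender. -/
def responseMatrix (R : Matrix (Fin q) (Fin t) ℝ)
    (Qr : Matrix (Fin q) (Fin p) ℝ) (Rr : Matrix (Fin q) (Fin t) ℝ) :
    Matrix (Fin q) (Fin p) ℝ :=
  R * (Rrᵀ * Rr)⁻¹ * Rrᵀ * Qr

/-- The matrix `V = Λᵀ Λ - Λᵀ Q - Qᵀ Λ` of a sender. -/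
def costMatrix (Q : Matrix (Fin q) (Fin p) ℝ) (R : Matrix (Fin q) (Fin t) ℝ)
    (Qr : Matrix (Fin q) (Fin p) ℝ) (Rr : Matrix (Fin q) (Fin t) ℝ) :
    Matrix (Fin p) (Fin p) ℝ :=
  (responseMatrix R Qr Rr)ᵀ * responseMatrix R Qr Rr
    - (responseMatrix R Qr Rr)ᵀ * Q - Qᵀ * responseMatrix R Qr Rr

/-- The positive semidefinite matrices `S` with `Sx ⪰ S ⪰ S₀`. -/
def feasible (Sx S₀ : Matrix (Fin p) (Fin p) ℝ) : Set (Matrix (Fin p) (Fin p) ℝ) :=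
  {S | S.PosSemidef ∧ (S - S₀).PosSemidef ∧ (Sx - S).PosSemidef}

/-- `S` is stable for a sender with cost matrix `V`: it is itself a minimizer of `Tr (V S')` over
all `S'` with `Sx ⪰ S' ⪰ S`. -/
def IsStable (Sx V S : Matrix (Fin p) (Fin p) ℝ) : Prop :=
  S ∈ feasible Sx S ∧ ∀ S' ∈ feasible Sx S, (V * S).trace ≤ (V * S').trace

/-- The nuclear norm of a matrix: the sum of its singular values. -/
def nuclearNorm (A : Matrix (Fin p) (Fin p) ℝ) : ℝ :=
  ∑ k ∈ Finset.range p, (toEuclideanLin A).singularValues k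

/-- `Sx^{-1/2} S Sx^{-1/2}`. -/
def whiten (Sx S : Matrix (Fin p) (Fin p) ℝ) : Matrix (Fin p) (Fin p) ℝ :=
  (CFC.sqrt Sx)⁻¹ * S * (CFC.sqrt Sx)⁻¹

/-- One iteration, for a sender with cost matrix `V`, from the current posterior `S₀` to a new one
`S'`: first `Tr (V S)` is minimized over `Sx ⪰ S ⪰ S₀`, then the nuclear norm of
`Sx^{-1/2} S' Sx^{-1/2}` over those `S'` with `Sx ⪰ S' ⪰ S₀` and `Tr (V S) ≥ Tr (V S')`. -/
def IsStep (Sx V S₀ S' : Matrix (Fin p) (Fin p) ℝ) : Prop :=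
  ∃ S ∈ feasible Sx S₀, (∀ T ∈ feasible Sx S₀, (V * S).trace ≤ (V * T).trace) ∧
    S' ∈ feasible Sx S₀ ∧ (V * S').trace ≤ (V * S).trace ∧
    ∀ T ∈ feasible Sx S₀, (V * T).trace ≤ (V * S).trace →
      nuclearNorm (whiten Sx S') ≤ nuclearNorm (whiten Sx T)

/-- `S` is returned by the sequential algorithm for senders with cost matrices `V i`, processed in
the order `N 0, N 1, …, N (m - 1)` and starting from the zero matrix. -/
def IsAlgorithmOutput (Sx : Matrix (Fin p) (Fin p) ℝ) (V : Fin m → Matrix (Fin p) (Fin p) ℝ)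
    (N : Equiv.Perm (Fin m)) (S : Matrix (Fin p) (Fin p) ℝ) : Prop :=
  ∃ T : Fin (m + 1) → Matrix (Fin p) (Fin p) ℝ, T 0 = 0 ∧
    (∀ j : Fin m, IsStep Sx (V (N j)) (T j.castSucc) (T j.succ)) ∧ T (Fin.last m) = S

end SDP

end StrategicCommunication

end

/-!
Whitening turns the matrices between `0` and `Sx` into the matrices `0 ≤ X ≤ 1`. For such an `X`,
both `X²` and `2 X - X²` stay above every projection below `X`, and their average is `X`; so when
`X` minimizes a linear functional, `X²` minimizes it as well. As `Tr X² ≤ Tr X`, with equality only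
for projections, and the nuclear norm is the trace on nonnegative matrices, every iteration of the
algorithm produces a projection. A matrix above a stable one is stable, since an increment available
above it is available below it too, so stability persists through later iterations.

The receiver's best response is linear in its estimate `x̂`, so the cost of a sender is a constant
plus `Tr (V E[x̂ x̂ᵀ])`. A deviation from policies that all reveal `L x` leaves the others revealing
`L x`, so it can only increase the posterior, and stability rules out a gain. A sole sender has no
such safeguard, but its output minimizes `Tr (V S)` over all feasible `S`. That the linear policy
induces `S` is the independence of uncorrelated linear images of a Gaussian vector.
-/

noncomputable section

namespace StrategicCommunication

section StarOrderedRing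

variable {R : Type*} [Ring R] [PartialOrder R] [StarRing R] [StarOrderedRing R] {p x : R}

lemma sub_mul_self_nonneg (h0 : 0 ≤ x) (h1 : x ≤ 1) : 0 ≤ x - x * x := by
  have hy0 : 0 ≤ 1 - x := sub_nonneg.2 h1
  have hsum : 0 ≤ x * (1 - x) * x + (1 - x) * x * (1 - x) :=
    add_nonneg ((IsSelfAdjoint.of_nonneg h0).conjugate_nonneg hy0)
      ((IsSelfAdjoint.of_nonneg hy0).conjugate_nonneg h0)
  convert hsum using 1
  noncomm_ring

lemma mul_self_mem_Icc (hp : IsStarProjection p) (hx : x ∈ Set.Icc p 1) (hpx : p * x = p)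
    (hxp : x * p = p) : x * x ∈ Set.Icc p 1 := by
  have h0 : 0 ≤ x := hp.nonneg.trans hx.1
  refine ⟨sub_nonneg.1 ?_, (sub_nonneg.1 (sub_mul_self_nonneg h0 hx.2)).trans hx.2⟩
  have hsq : x * x - p = (x - p) * (x - p) := by
    rw [sub_mul, mul_sub, mul_sub, hpx, hxp, hp.isIdempotentElem.eq]
    abel
  rw [hsq]
  exact ((IsSelfAdjoint.of_nonneg h0).sub hp.isSelfAdjoint).mul_self_nonneg

lemma add_sub_mul_self_mem_Icc (h0 : 0 ≤ x) (hx : x ∈ Set.Icc p 1) :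
    x + (x - x * x) ∈ Set.Icc p 1 := by
  refine ⟨hx.1.trans (le_add_of_nonneg_right (sub_mul_self_nonneg h0 hx.2)), sub_nonneg.1 ?_⟩
  have hsq : 1 - (x + (x - x * x)) = (1 - x) * (1 - x) := by noncomm_ring
  rw [hsq]
  exact (IsSelfAdjoint.of_nonneg (sub_nonneg.2 hx.2)).mul_self_nonneg

end StarOrderedRing

section Projection

variable {n : Type*} [Fintype n] {P₀ V X : Matrix n n ℝ}

lemma mul_eq_zero_of_star_mul_mul_eq_zero {A C : Matrix n n ℝ} (hA : 0 ≤ A)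
    (h : star C * A * C = 0) : A * C = 0 := by
  classical
  obtain ⟨B, rfl⟩ := CStarAlgebra.nonneg_iff_eq_star_mul_self.mp hA
  have hBC : B * C = 0 := by
    rw [← conjTranspose_mul_self_eq_zero, ← star_eq_conjTranspose, star_mul, ← h]
    simp only [mul_assoc]
  rw [mul_assoc, hBC, mul_zero]

variable [DecidableEq n]

lemma mul_eq_right_of_mem_Icc (hP : IsStarProjection P₀) (hX : X ∈ Set.Icc P₀ 1) :
    X * P₀ = P₀ := by
  have hconj : P₀ * (1 - X) * P₀ = 0 := by
    refine le_antisymm ?_ (hP.isSelfAdjoint.conjugate_nonneg (sub_nonneg.2 hX.2))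
    have h := hP.isSelfAdjoint.conjugate_le_conjugate (sub_le_sub_left hX.1 1)
    rwa [hP.mul_one_sub_self, zero_mul] at h
  have hX' : (1 - X) * P₀ = 0 := by
    refine mul_eq_zero_of_star_mul_mul_eq_zero (sub_nonneg.2 hX.2) ?_
    rwa [hP.isSelfAdjoint.star_eq]
  rw [sub_mul, one_mul, sub_eq_zero] at hX'
  exact hX'.symm

/-- On `Icc P₀ 1` both `X * X` and `X + (X - X * X)` are competitors of `X`, so a linear functional
minimized at `X` vanishes on `X - X * X`, and a minimizer of least trace satisfies `X * X = X`. -/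
lemma isStarProjection_of_isMinOn_trace (hP : IsStarProjection P₀) (hX : X ∈ Set.Icc P₀ 1)
    (hmin : ∀ Y ∈ Set.Icc P₀ 1, (V * X).trace ≤ (V * Y).trace)
    (hleast : ∀ Y ∈ Set.Icc P₀ 1, (V * Y).trace ≤ (V * X).trace → X.trace ≤ Y.trace) :
    IsStarProjection X := by
  have h0 : 0 ≤ X := hP.nonneg.trans hX.1
  have hXP : X * P₀ = P₀ := mul_eq_right_of_mem_Icc hP hX
  have hPX : P₀ * X = P₀ := by
    simpa only [star_mul, hP.isSelfAdjoint.star_eq, (IsSelfAdjoint.of_nonneg h0).star_eq]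
      using congrArg star hXP
  have hsq : X * X ∈ Set.Icc P₀ 1 := mul_self_mem_Icc hP hX hPX hXP
  have hVsq : (V * (X * X)).trace ≤ (V * X).trace := by
    have h := hmin _ (add_sub_mul_self_mem_Icc h0 hX)
    rw [mul_add, mul_sub, trace_add, trace_sub] at h
    linarith
  have hD : (X - X * X).PosSemidef := nonneg_iff_posSemidef.1 (sub_mul_self_nonneg h0 hX.2)
  have htr : (X - X * X).trace = 0 := by
    refine le_antisymm ?_ hD.trace_nonneg
    rw [trace_sub, sub_nonpos]
    exact hleast _ hsq hVsq
  exact ⟨(sub_eq_zero.1 (hD.trace_eq_zero_iff.1 htr)).symm, .of_nonneg h0⟩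

end Projection

section SingularValues

variable {𝕜 E : Type*} [RCLike 𝕜] [NormedAddCommGroup E] [InnerProductSpace 𝕜 E]
  {T : E →ₗ[𝕜] E}

lemma apply_eq_smul_of_apply_apply_eq_sq_smul (hT : T.IsPositive) {σ : ℝ} (hσ : 0 ≤ σ) {v : E}
    (h : T (T v) = ((σ ^ 2 : ℝ) : 𝕜) • v) : T v = (σ : 𝕜) • v := by
  rcases hσ.eq_or_lt with rfl | hσ
  · have hinner : inner 𝕜 (T v) (T v) = 0 := by
      rw [← hT.isSymmetric, h]
      simp
    simpa using hinner
  set w := T v - (σ : 𝕜) • v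
  have hTw : T w = -((σ : 𝕜) • w) := by
    simp only [w, map_sub, map_smul, h, smul_sub, smul_smul, sq, RCLike.ofReal_mul, neg_sub]
  have hw : 0 ≤ -(σ * ‖w‖ ^ 2) := by
    have hpos := hT.re_inner_nonneg_left w
    rwa [hTw, inner_neg_left, inner_smul_left, RCLike.conj_ofReal, inner_self_eq_norm_sq_to_K,
      ← RCLike.ofReal_pow, ← RCLike.ofReal_mul, map_neg, RCLike.ofReal_re] at hpos
  have hw0 : ‖w‖ ^ 2 = 0 :=
    le_antisymm (nonpos_of_mul_nonpos_right (neg_nonneg.1 hw) hσ) (sq_nonneg _)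
  exact sub_eq_zero.1 (norm_eq_zero.1 (pow_eq_zero_iff two_ne_zero |>.1 hw0))

lemma trace_eq_sum_singularValues [FiniteDimensional 𝕜 E] (hT : T.IsPositive) :
    LinearMap.trace 𝕜 E T =
      ((∑ i ∈ Finset.range (Module.finrank 𝕜 E), T.singularValues i : ℝ) : 𝕜) := by
  set b := T.isSymmetric_adjoint_comp_self.eigenvectorBasis rfl
  have hb (i) : T (b i) = (T.singularValues i : 𝕜) • b i := by
    apply apply_eq_smul_of_apply_apply_eq_sq_smul hT (T.singularValues_nonneg _)
    have hTT : T (T (b i)) = (T.adjoint ∘ₗ T) (b i) :=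
      (LinearMap.congr_fun hT.adjoint_eq (T (b i))).symm
    rw [hTT, T.sq_singularValues_fin rfl]
    exact T.isSymmetric_adjoint_comp_self.apply_eigenvectorBasis rfl i
  rw [T.trace_eq_sum_inner b, Finset.sum_range, RCLike.ofReal_sum]
  exact Finset.sum_congr rfl fun i _ => by
    rw [hb, inner_smul_right, inner_self_eq_norm_sq_to_K, b.norm_eq_one]; simp

end SingularValues

lemma nuclearNorm_eq_trace {p : ℕ} {A : Matrix (Fin p) (Fin p) ℝ} (hA : A.PosSemidef) :
    nuclearNorm A = A.trace := by
  have h := trace_eq_sum_singularValues (isPositive_toEuclideanLin_iff.2 hA)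
  rw [toEuclideanLin_eq_toLin_orthonormal, trace_toLin_eq, finrank_euclideanSpace_fin] at h
  exact h.symm

section Algorithm

variable {p : ℕ} {Sx V S S₀ T : Matrix (Fin p) (Fin p) ℝ}

lemma feasible_eq_Icc (h₀ : 0 ≤ S₀) : feasible Sx S₀ = Set.Icc S₀ Sx := by
  ext S
  exact ⟨And.right, fun h => ⟨nonneg_iff_posSemidef.1 (h₀.trans h.1), h⟩⟩

lemma sqrt_mul_sqrt (hSx : Sx.PosDef) : CFC.sqrt Sx * CFC.sqrt Sx = Sx :=
  CFC.sqrt_mul_sqrt_self Sx hSx.posSemidef.nonneg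

lemma isUnit_det_sqrt (hSx : Sx.PosDef) : IsUnit (CFC.sqrt Sx).det := by
  refine isUnit_of_mul_isUnit_left (y := (CFC.sqrt Sx).det) ?_
  rw [← det_mul, sqrt_mul_sqrt hSx]
  exact hSx.det_pos.ne'.isUnit

lemma isSelfAdjoint_sqrt : IsSelfAdjoint (CFC.sqrt Sx) := .of_nonneg (CFC.sqrt_nonneg Sx)

lemma isSelfAdjoint_inv_sqrt : IsSelfAdjoint (CFC.sqrt Sx)⁻¹ := by
  rw [IsSelfAdjoint, star_eq_conjTranspose, conjTranspose_nonsing_inv, ← star_eq_conjTranspose,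
    isSelfAdjoint_sqrt.star_eq]

lemma sqrt_mul_whiten_mul_sqrt (hSx : Sx.PosDef) (S : Matrix (Fin p) (Fin p) ℝ) :
    CFC.sqrt Sx * whiten Sx S * CFC.sqrt Sx = S := by
  simp only [whiten, mul_assoc, nonsing_inv_mul _ (isUnit_det_sqrt hSx), mul_one]
  rw [mul_nonsing_inv_cancel_left _ _ (isUnit_det_sqrt hSx)]

lemma whiten_sqrt_mul_mul_sqrt (hSx : Sx.PosDef) (W : Matrix (Fin p) (Fin p) ℝ) :
    whiten Sx (CFC.sqrt Sx * W * CFC.sqrt Sx) = W := by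
  simp only [whiten, mul_assoc, mul_nonsing_inv _ (isUnit_det_sqrt hSx), mul_one]
  rw [nonsing_inv_mul_cancel_left _ _ (isUnit_det_sqrt hSx)]

lemma whiten_surjective (hSx : Sx.PosDef) : Function.Surjective (whiten Sx) :=
  fun W => ⟨_, whiten_sqrt_mul_mul_sqrt hSx W⟩

lemma whiten_self (hSx : Sx.PosDef) : whiten Sx Sx = 1 := by
  have h := whiten_sqrt_mul_mul_sqrt hSx 1
  rwa [mul_one, sqrt_mul_sqrt hSx] at h

lemma inv_sqrt_mul_self (hSx : Sx.PosDef) : (CFC.sqrt Sx)⁻¹ * Sx = CFC.sqrt Sx := by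
  nth_rewrite 2 [← sqrt_mul_sqrt hSx]
  rw [nonsing_inv_mul_cancel_left _ _ (isUnit_det_sqrt hSx)]

lemma whiten_zero : whiten Sx 0 = 0 := by rw [whiten, mul_zero, zero_mul]

lemma whiten_le_whiten_iff (hSx : Sx.PosDef) : whiten Sx S ≤ whiten Sx T ↔ S ≤ T := by
  refine ⟨fun h => ?_, fun h => isSelfAdjoint_inv_sqrt.conjugate_le_conjugate h⟩
  rw [← sqrt_mul_whiten_mul_sqrt hSx S, ← sqrt_mul_whiten_mul_sqrt hSx T]
  exact isSelfAdjoint_sqrt.conjugate_le_conjugate h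

lemma nonneg_whiten_iff (hSx : Sx.PosDef) : 0 ≤ whiten Sx S ↔ 0 ≤ S := by
  rw [← whiten_le_whiten_iff hSx (S := 0) (T := S), whiten_zero]

lemma whiten_mem_Icc_iff (hSx : Sx.PosDef) (h₀ : 0 ≤ S₀) :
    whiten Sx S ∈ Set.Icc (whiten Sx S₀) 1 ↔ S ∈ feasible Sx S₀ := by
  rw [feasible_eq_Icc h₀, ← whiten_self hSx, Set.mem_Icc, Set.mem_Icc, whiten_le_whiten_iff hSx,
    whiten_le_whiten_iff hSx]

lemma trace_sqrt_mul_mul_sqrt_mul_whiten (hSx : Sx.PosDef) (V S : Matrix (Fin p) (Fin p) ℝ) :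
    (CFC.sqrt Sx * V * CFC.sqrt Sx * whiten Sx S).trace = (V * S).trace := by
  conv_rhs => rw [← sqrt_mul_whiten_mul_sqrt hSx S]
  rw [mul_assoc, mul_assoc, trace_mul_comm]
  simp only [mul_assoc]

lemma IsStep.trace_le (h : IsStep Sx V S₀ S) (hT : T ∈ feasible Sx S₀) :
    (V * S).trace ≤ (V * T).trace := by
  obtain ⟨_, -, hmin, -, hle, -⟩ := h
  exact hle.trans (hmin T hT)

lemma IsStep.mem_feasible (h : IsStep Sx V S₀ S) : S ∈ feasible Sx S₀ := by
  obtain ⟨_, -, -, hS, -⟩ := h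
  exact hS

lemma feasible_self (h : S ∈ feasible Sx S₀) : S ∈ feasible Sx S :=
  ⟨h.1, nonneg_iff_posSemidef.1 (sub_self S).ge, h.2.2⟩

lemma feasible_trans (h : S ∈ feasible Sx S₀) (hT : T ∈ feasible Sx S) : T ∈ feasible Sx S₀ :=
  ⟨hT.1, (Matrix.le_iff.2 h.2.1).trans (Matrix.le_iff.2 hT.2.1), hT.2.2⟩

lemma IsStep.isStable (h : IsStep Sx V S₀ S) : IsStable Sx V S :=
  ⟨feasible_self h.mem_feasible, fun _ hT => h.trace_le (feasible_trans h.mem_feasible hT)⟩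

/-- If `Sx ⪰ T ⪰ S ⪰ S₀`, then `S₀ + (T - S)` competes with `S₀`. -/
lemma IsStable.of_mem_feasible (h : IsStable Sx V S₀) (hS : S ∈ feasible Sx S₀) :
    IsStable Sx V S := by
  refine ⟨feasible_self hS, fun T hT => ?_⟩
  have hmem : S₀ + (T - S) ∈ feasible Sx S₀ := by
    refine ⟨h.1.1.add hT.2.1, by simpa only [add_sub_cancel_left] using hT.2.1, ?_⟩
    have hsplit : Sx - (S₀ + (T - S)) = Sx - T + (S - S₀) := by abel
    rw [hsplit]
    exact hT.2.2.add hS.2.1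
  have htrace := h.2 _ hmem
  rw [mul_add, mul_sub, trace_add, trace_sub] at htrace
  linarith

lemma IsStep.isStarProjection_whiten (hSx : Sx.PosDef) (h : IsStep Sx V S₀ S)
    (hS₀ : IsStarProjection (whiten Sx S₀)) : IsStarProjection (whiten Sx S) := by
  have hmem (T : Matrix (Fin p) (Fin p) ℝ) := whiten_mem_Icc_iff (S := T) hSx
    ((nonneg_whiten_iff hSx).1 hS₀.nonneg)
  refine isStarProjection_of_isMinOn_trace (V := CFC.sqrt Sx * V * CFC.sqrt Sx) hS₀
    ((hmem S).2 h.mem_feasible) ?_ ?_ <;>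
    rw [(whiten_surjective hSx).forall] <;>
    simp only [trace_sqrt_mul_mul_sqrt_mul_whiten hSx, hmem]
  · exact fun T hT => h.trace_le hT
  · intro T hT hle
    obtain ⟨_, -, -, hS, hSle, hnuc⟩ := h
    have hnn {T} (hT : T ∈ feasible Sx S₀) : (whiten Sx T).PosSemidef :=
      nonneg_iff_posSemidef.1 ((nonneg_whiten_iff hSx).2 hT.1.nonneg)
    rw [← nuclearNorm_eq_trace (hnn hS), ← nuclearNorm_eq_trace (hnn hT)]
    exact hnuc T hT (hle.trans hSle)

variable {m : ℕ} {V : Fin m → Matrix (Fin p) (Fin p) ℝ} {N : Equiv.Perm (Fin m)}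

lemma isStarProjection_whiten_of_isStep (hSx : Sx.PosDef)
    {T : Fin (m + 1) → Matrix (Fin p) (Fin p) ℝ} (h₀ : T 0 = 0)
    (hT : ∀ j, IsStep Sx (V (N j)) (T j.castSucc) (T j.succ)) (j : Fin (m + 1)) :
    IsStarProjection (whiten Sx (T j)) := by
  induction j using Fin.induction with
  | zero => rw [h₀, whiten_zero]; exact .zero _
  | succ j ih => exact (hT j).isStarProjection_whiten hSx ih

lemma isStable_of_isStep {T : Fin (m + 1) → Matrix (Fin p) (Fin p) ℝ}
    (hT : ∀ j, IsStep Sx (V (N j)) (T j.castSucc) (T j.succ)) {j : Fin (m + 1)} {k : Fin m}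
    (hk : k.castSucc < j) : IsStable Sx (V (N k)) (T j) := by
  induction j using Fin.induction with
  | zero => exact absurd hk (Fin.not_lt_zero _)
  | succ j ih =>
    rcases (Fin.castSucc_lt_succ_iff.1 hk).lt_or_eq with hlt | rfl
    · exact (ih (Fin.castSucc_lt_castSucc_iff.2 hlt)).of_mem_feasible (hT j).mem_feasible
    · exact (hT k).isStable

lemma IsAlgorithmOutput.isStarProjection_whiten (hSx : Sx.PosDef)
    (h : IsAlgorithmOutput Sx V N S) : IsStarProjection (whiten Sx S) := by
  obtain ⟨T, h₀, hT, rfl⟩ := h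
  exact isStarProjection_whiten_of_isStep hSx h₀ hT _

lemma IsAlgorithmOutput.isStable (h : IsAlgorithmOutput Sx V N S) (i : Fin m) :
    IsStable Sx (V i) S := by
  obtain ⟨T, -, hT, rfl⟩ := h
  simpa only [Equiv.apply_symm_apply] using
    isStable_of_isStep hT (Fin.castSucc_lt_last (N.symm i))

lemma IsAlgorithmOutput.trace_le_of_subsingleton [Subsingleton (Fin m)]
    (h : IsAlgorithmOutput Sx V N S) (i : Fin m) (hT : T ∈ feasible Sx 0) :
    (V i * S).trace ≤ (V i * T).trace := by
  obtain ⟨R, h₀, hR, rfl⟩ := h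
  obtain rfl : m = 1 := le_antisymm (Fin.subsingleton_iff_le_one.1 ‹_›) (Fin.pos i)
  have hstep := hR 0
  rw [Subsingleton.elim (N 0) i, Fin.castSucc_zero, h₀] at hstep
  exact hstep.trace_le hT

lemma IsAlgorithmOutput.eq_zero_of_isEmpty [IsEmpty (Fin m)] (h : IsAlgorithmOutput Sx V N S) :
    S = 0 := by
  obtain ⟨R, h₀, -, rfl⟩ := h
  obtain rfl : m = 0 := (Fintype.card_fin m).symm.trans Fintype.card_eq_zero
  exact h₀

end Algorithm

section Orthogonality

variable {Ω E F G : Type*} {𝓖 mΩ : MeasurableSpace Ω} {P : Measure Ω}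
  [NormedAddCommGroup E] [NormedAddCommGroup F] [NormedAddCommGroup G]

lemma memLp_two_iff_lintegral_ne_top {f : Ω → E} (hf : AEStronglyMeasurable f P) :
    MemLp f 2 P ↔ ∫⁻ ω, ‖f ω‖ₑ ^ 2 ∂P ≠ ∞ := by
  rw [MemLp, and_iff_right hf,
    eLpNorm_lt_top_iff_lintegral_rpow_enorm_lt_top two_ne_zero ENNReal.ofNat_ne_top,
    lt_top_iff_ne_top]
  simp only [ENNReal.toReal_ofNat, ENNReal.rpow_ofNat]

lemma lintegral_enorm_sq_eq_ofReal {f : Ω → E} (hf : MemLp f 2 P) :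
    ∫⁻ ω, ‖f ω‖ₑ ^ 2 ∂P = ENNReal.ofReal (∫ ω, ‖f ω‖ ^ 2 ∂P) := by
  rw [ofReal_integral_eq_lintegral_ofReal
    ((memLp_two_iff_integrable_sq_norm hf.aestronglyMeasurable).1 hf)
    (.of_forall fun ω => sq_nonneg _)]
  simp only [ENNReal.ofReal_pow (norm_nonneg _), ofReal_norm]

lemma integrable_bilin [NormedSpace ℝ E] [NormedSpace ℝ F] [NormedSpace ℝ G]
    (B : E →L[ℝ] F →L[ℝ] G) {f : Ω → E} {g : Ω → F} (hf : MemLp f 2 P) (hg : MemLp g 2 P) :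
    Integrable (fun ω => B (f ω) (g ω)) P :=
  memLp_one_iff_integrable.1 (B.memLp_of_bilin 1 hf hg)

lemma condExp_continuousLinearMap_comp_eq_zero [NormedSpace ℝ E] [NormedSpace ℝ F] [CompleteSpace E]
    [CompleteSpace F] (T : E →L[ℝ] F) {f : Ω → E} (hf : Integrable f P) (hf₀ : P[f | 𝓖] =ᵐ[P] 0) :
    P[T ∘ f | 𝓖] =ᵐ[P] 0 := by
  filter_upwards [T.comp_condExp_comm hf (m := 𝓖), hf₀] with ω hT hω
  rw [← hT, Function.comp_apply, hω, Pi.zero_apply, map_zero, Pi.zero_apply]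

variable [IsFiniteMeasure P]

lemma integral_bilin_eq_zero_of_condExp_eq_zero [NormedSpace ℝ E] [NormedSpace ℝ F]
    [NormedSpace ℝ G] [CompleteSpace E] [CompleteSpace G] (h𝓖 : 𝓖 ≤ mΩ) (B : E →L[ℝ] F →L[ℝ] G)
    {f : Ω → E} {g : Ω → F} (hf : MemLp f 2 P) (hg : MemLp g 2 P) (hf₀ : P[f | 𝓖] =ᵐ[P] 0)
    (hg𝓖 : AEStronglyMeasurable[𝓖] g P) : ∫ ω, B (f ω) (g ω) ∂P = 0 := by
  have pull_out := condExp_bilin_of_aestronglyMeasurable_right B hg𝓖 (integrable_bilin B hf hg)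
    (hf.integrable one_le_two)
  rw [← integral_condExp h𝓖, integral_congr_ae pull_out]
  refine integral_eq_zero_of_ae ?_
  filter_upwards [hf₀] with ω hω
  rw [hω, Pi.zero_apply, map_zero, _root_.zero_apply, Pi.zero_apply]

/-- If `g` is not square integrable, both sides are infinite. -/
lemma lintegral_enorm_add_sq_of_condExp_eq_zero [InnerProductSpace ℝ E] [CompleteSpace E]
    (h𝓖 : 𝓖 ≤ mΩ) {f g : Ω → E} (hf : MemLp f 2 P) (hf₀ : P[f | 𝓖] =ᵐ[P] 0)
    (hg : AEStronglyMeasurable[𝓖] g P) :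
    ∫⁻ ω, ‖f ω + g ω‖ₑ ^ 2 ∂P = ∫⁻ ω, ‖f ω‖ₑ ^ 2 ∂P + ∫⁻ ω, ‖g ω‖ₑ ^ 2 ∂P := by
  have hgm : AEStronglyMeasurable g P := hg.mono h𝓖
  by_cases hg2 : MemLp g 2 P
  · have sq_integrable {u : Ω → E} (hu : MemLp u 2 P) : Integrable (fun ω => ‖u ω‖ ^ 2) P :=
      (memLp_two_iff_integrable_sq_norm hu.aestronglyMeasurable).1 hu
    have inner_integrable : Integrable (fun ω => 2 * inner ℝ (f ω) (g ω)) P :=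
      (integrable_bilin (innerSL ℝ) hf hg2).const_mul 2
    have orthogonal : ∫ ω, inner ℝ (f ω) (g ω) ∂P = 0 :=
      integral_bilin_eq_zero_of_condExp_eq_zero h𝓖 (innerSL ℝ) hf hg2 hf₀ hg
    have pythagoras : ∫ ω, ‖f ω + g ω‖ ^ 2 ∂P = ∫ ω, ‖f ω‖ ^ 2 ∂P + ∫ ω, ‖g ω‖ ^ 2 ∂P := by
      simp only [norm_add_sq_real]
      rw [integral_add ((sq_integrable hf).fun_add inner_integrable) (sq_integrable hg2),
        integral_add (sq_integrable hf) inner_integrable, integral_const_mul, orthogonal, mul_zero,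
        add_zero]
    rw [lintegral_enorm_sq_eq_ofReal hf, lintegral_enorm_sq_eq_ofReal hg2,
      ← ENNReal.ofReal_add (by positivity) (by positivity), ← pythagoras]
    exact lintegral_enorm_sq_eq_ofReal (hf.add hg2)
  · have hfg : ¬ MemLp (f + g) 2 P := fun h => hg2 (by simpa using h.sub hf)
    rw [memLp_two_iff_lintegral_ne_top hgm, not_ne_iff] at hg2
    rw [memLp_two_iff_lintegral_ne_top (hf.aestronglyMeasurable.add hgm), not_ne_iff] at hfg
    rw [hg2, add_top]
    exact hfg

lemma condExp_sub_condExp_eq_zero [NormedSpace ℝ E] [CompleteSpace E] (h𝓖 : 𝓖 ≤ mΩ) {f : Ω → E}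
    (hf : Integrable f P) : P[f - P[f | 𝓖] | 𝓖] =ᵐ[P] 0 := by
  refine (condExp_sub hf integrable_condExp 𝓖).trans ?_
  rw [condExp_of_stronglyMeasurable h𝓖 stronglyMeasurable_condExp integrable_condExp, sub_self]

lemma condExp_add_of_indep [NormedSpace ℝ E] [CompleteSpace E] {m : MeasurableSpace Ω} (hm : m ≤ mΩ)
    (h𝓖 : 𝓖 ≤ mΩ) {f g : Ω → E} (hf : Integrable f P) (hf𝓖 : StronglyMeasurable[𝓖] f)
    (hg : Integrable g P) (hgm : StronglyMeasurable[m] g) (hg₀ : ∫ ω, g ω ∂P = 0)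
    (hind : Indep m 𝓖 P) : P[f + g | 𝓖] =ᵐ[P] f := by
  filter_upwards [condExp_add hf hg 𝓖, condExp_indep_eq hm h𝓖 hgm hind] with ω hadd hω
  rw [hadd, Pi.add_apply, hω, hg₀, add_zero, condExp_of_stronglyMeasurable h𝓖 hf𝓖 hf]

end Orthogonality

section SecondMoment

variable {Ω ι κ : Type*} {𝓖 mΩ : MeasurableSpace Ω} {P : Measure Ω}
  {y z : Ω → EuclideanSpace ℝ ι}

/-- The (uncentered) second moment matrix `E[y yᵀ]` of a random vector `y`. -/
def secondMoment (P : Measure Ω) (y : Ω → EuclideanSpace ℝ ι) : Matrix ι ι ℝ :=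
  Matrix.of fun a b => ∫ ω, y ω a * y ω b ∂P

lemma secondMoment_congr (h : y =ᵐ[P] z) : secondMoment P y = secondMoment P z := by
  ext a b
  refine integral_congr_ae ?_
  filter_upwards [h] with ω hω
  rw [hω]

variable [Fintype ι]

lemma memLp_apply (hy : MemLp y 2 P) (a : ι) : MemLp (fun ω => y ω a) 2 P :=
  (PiLp.proj 2 (fun _ : ι => ℝ) a : _ →L[ℝ] ℝ).comp_memLp' hy

lemma integrable_apply_mul_apply (hy : MemLp y 2 P) (hz : MemLp z 2 P) (a b : ι) :
    Integrable (fun ω => y ω a * z ω b) P :=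
  (memLp_apply hy a).integrable_mul (memLp_apply hz b)

lemma memLp_toEuclideanLin [DecidableEq ι] [Fintype κ] (hy : MemLp y 2 P) (A : Matrix κ ι ℝ) :
    MemLp (fun ω => toEuclideanLin A (y ω)) 2 P :=
  (toEuclideanLin A).toContinuousLinearMap.comp_memLp' hy

lemma secondMoment_toEuclideanLin [DecidableEq ι] (hy : MemLp y 2 P) (A : Matrix κ ι ℝ) :
    secondMoment P (fun ω => toEuclideanLin A (y ω)) = A * secondMoment P y * Aᵀ := by
  ext a b
  have hint (i j : ι) : Integrable (fun ω => A a i * A b j * (y ω i * y ω j)) P :=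
    (integrable_apply_mul_apply hy hy i j).const_mul _
  calc ∫ ω, (∑ i, A a i * y ω i) * ∑ j, A b j * y ω j ∂P
      = ∫ ω, ∑ j, ∑ i, A a i * A b j * (y ω i * y ω j) ∂P := by
        refine integral_congr_ae (.of_forall fun ω => ?_)
        simp only [Finset.sum_mul_sum, mul_mul_mul_comm]
        exact Finset.sum_comm
    _ = ∑ j, ∑ i, A a i * A b j * ∫ ω, y ω i * y ω j ∂P := by
        rw [integral_finsetSum _ fun j _ => integrable_finsetSum _ fun i _ => hint i j]
        simp only [integral_finsetSum _ fun i _ => hint i _, integral_const_mul]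
    _ = (A * secondMoment P y * Aᵀ) a b := by
        simp only [mul_apply, Finset.sum_mul, transpose_apply, secondMoment, of_apply,
          mul_right_comm]

lemma secondMoment_nonneg (hy : MemLp y 2 P) : 0 ≤ secondMoment P y := by
  classical
  refine nonneg_iff_posSemidef.2 (.of_dotProduct_mulVec_nonneg ?_ fun v => ?_)
  · ext a b
    exact integral_congr_ae (.of_forall fun ω => mul_comm _ _)
  · have h := congrFun₂ (secondMoment_toEuclideanLin hy (replicateRow (Fin 1) v)) 0 0
    rw [Matrix.mul_assoc] at h
    exact (integral_nonneg fun ω => mul_self_nonneg _).trans_eq h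

lemma lintegral_enorm_sq_eq_trace (hy : MemLp y 2 P) :
    ∫⁻ ω, ‖y ω‖ₑ ^ 2 ∂P = ENNReal.ofReal (secondMoment P y).trace := by
  rw [lintegral_enorm_sq_eq_ofReal hy]
  simp only [EuclideanSpace.real_norm_sq_eq]
  simp only [pow_two, integral_finsetSum _ fun a _ => integrable_apply_mul_apply hy hy a a]
  rfl

lemma lintegral_enorm_toEuclideanLin_sq [DecidableEq ι] [Fintype κ] (hy : MemLp y 2 P)
    (A : Matrix κ ι ℝ) :
    ∫⁻ ω, ‖toEuclideanLin A (y ω)‖ₑ ^ 2 ∂P = ENNReal.ofReal (A * secondMoment P y * Aᵀ).trace := by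
  rw [lintegral_enorm_sq_eq_trace (memLp_toEuclideanLin hy A), secondMoment_toEuclideanLin hy]

variable [IsFiniteMeasure P]

lemma secondMoment_add_of_condExp_eq_zero (h𝓖 : 𝓖 ≤ mΩ) (hy : MemLp y 2 P) (hz : MemLp z 2 P)
    (hy₀ : P[y | 𝓖] =ᵐ[P] 0) (hz𝓖 : AEStronglyMeasurable[𝓖] z P) :
    secondMoment P (y + z) = secondMoment P y + secondMoment P z := by
  have hyy := integrable_apply_mul_apply hy hy
  have hzz := integrable_apply_mul_apply hz hz
  have hyz := integrable_apply_mul_apply hy hz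
  have orthogonal (a b : ι) : ∫ ω, y ω a * z ω b ∂P = 0 :=
    integral_bilin_eq_zero_of_condExp_eq_zero h𝓖
      ((ContinuousLinearMap.mul ℝ ℝ).bilinearComp (PiLp.proj 2 (fun _ : ι => ℝ) a)
        (PiLp.proj 2 (fun _ : ι => ℝ) b)) hy hz hy₀ hz𝓖
  ext a b
  calc ∫ ω, (y ω a + z ω a) * (y ω b + z ω b) ∂P
      = ∫ ω, (y ω a * y ω b + z ω a * z ω b + (y ω a * z ω b + y ω b * z ω a)) ∂P := by
        refine integral_congr_ae (.of_forall fun ω => ?_)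
        ring
    _ = ∫ ω, y ω a * y ω b ∂P + ∫ ω, z ω a * z ω b ∂P := by
        rw [integral_add ((hyy a b).fun_add (hzz a b)) ((hyz a b).fun_add (hyz b a)),
          integral_add (hyy a b) (hzz a b), integral_add (hyz a b) (hyz b a), orthogonal,
          orthogonal, add_zero, add_zero]

lemma secondMoment_sub_condExp_add_secondMoment_condExp (h𝓖 : 𝓖 ≤ mΩ) (hy : MemLp y 2 P) :
    secondMoment P (y - P[y | 𝓖]) + secondMoment P (P[y | 𝓖]) = secondMoment P y := by
  have hcond : MemLp (P[y | 𝓖]) 2 P := hy.condExp one_le_two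
  rw [← secondMoment_add_of_condExp_eq_zero h𝓖 (hy.sub hcond) hcond
    (condExp_sub_condExp_eq_zero h𝓖 (hy.integrable one_le_two))
    stronglyMeasurable_condExp.aestronglyMeasurable, sub_add_cancel]

lemma secondMoment_condExp_le (h𝓖 : 𝓖 ≤ mΩ) (hy : MemLp y 2 P) :
    secondMoment P (P[y | 𝓖]) ≤ secondMoment P y := by
  rw [← secondMoment_sub_condExp_add_secondMoment_condExp h𝓖 hy]
  exact le_add_of_nonneg_left (secondMoment_nonneg (hy.sub (hy.condExp one_le_two)))

end SecondMoment

section Posterior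

variable {m p : ℕ} {Ω : Type*} [MeasurableSpace Ω] {P : Measure Ω}
  {x : Ω → EuclideanSpace ℝ (Fin p)} {η : Policies m p}

lemma measurable_signals (hx : Measurable x) (hη : ∀ i, Measurable (η i)) :
    Measurable (signals x η) :=
  measurable_pi_lambda _ fun i => (hη i).comp hx

omit [MeasurableSpace Ω] in
lemma comap_signals_const_le {f : EuclideanSpace ℝ (Fin p) → EuclideanSpace ℝ (Fin p)} (i : Fin m)
    (hi : η i = f) :
    MeasurableSpace.comap (signals x fun _ : Fin m => f) inferInstance ≤
      MeasurableSpace.comap (signals x η) inferInstance := by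
  have hfun : (signals x fun _ : Fin m => f) = (fun y _ => y i) ∘ signals x η := by
    rw [← hi]
    rfl
  rw [hfun, ← MeasurableSpace.comap_comp]
  exact MeasurableSpace.comap_mono
    (measurable_pi_lambda (fun (y : Fin m → EuclideanSpace ℝ (Fin p)) (_ : Fin m) => y i)
      fun _ => measurable_pi_apply i).comap_le

lemma memLp_posteriorEstimate (hx2 : MemLp x 2 P) : MemLp (posteriorEstimate P x η) 2 P :=
  hx2.condExp one_le_two

variable [IsFiniteMeasure P]

lemma posteriorCov_mem_feasible (hs : Measurable (signals x η)) (hx2 : MemLp x 2 P) :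
    posteriorCov P x η ∈ feasible (secondMoment P x) 0 := by
  rw [feasible_eq_Icc le_rfl]
  exact ⟨secondMoment_nonneg (memLp_posteriorEstimate hx2), secondMoment_condExp_le hs.comap_le hx2⟩

lemma posteriorCov_mono {η' : Policies m p} (hs' : Measurable (signals x η')) (hx2 : MemLp x 2 P)
    (hle : MeasurableSpace.comap (signals x η) inferInstance ≤
      MeasurableSpace.comap (signals x η') inferInstance) :
    posteriorCov P x η ≤ posteriorCov P x η' := by
  have tower : P[posteriorEstimate P x η' | MeasurableSpace.comap (signals x η) inferInstance]
      =ᵐ[P] posteriorEstimate P x η := condExp_condExp_of_le hle hs'.comap_le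
  have h := secondMoment_condExp_le (hle.trans hs'.comap_le) (memLp_posteriorEstimate hx2 (η := η'))
  rwa [secondMoment_congr tower] at h

lemma secondMoment_sub_posteriorEstimate (hs : Measurable (signals x η)) (hx2 : MemLp x 2 P) :
    secondMoment P (x - posteriorEstimate P x η) = secondMoment P x - posteriorCov P x η :=
  eq_sub_of_add_eq (secondMoment_sub_condExp_add_secondMoment_condExp hs.comap_le hx2)

end Posterior

section LeastSquares

variable {ι κ τ : Type*} [Fintype κ] [Fintype τ] [DecidableEq τ]

/-- The matrix `K` of the least-squares solution `u = -K v` of `Q v + R u = 0`, which is the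
receiver's optimal action given the estimate `v`. -/
def receiverGain (Q : Matrix κ ι ℝ) (R : Matrix κ τ ℝ) : Matrix τ ι ℝ :=
  (Rᵀ * R)⁻¹ * Rᵀ * Q

lemma responseMatrix_eq_mul_receiverGain {p q t : ℕ} (R : Matrix (Fin q) (Fin t) ℝ)
    (Qr : Matrix (Fin q) (Fin p) ℝ) (Rr : Matrix (Fin q) (Fin t) ℝ) :
    responseMatrix R Qr Rr = R * receiverGain Qr Rr := by
  simp only [responseMatrix, receiverGain, Matrix.mul_assoc]

lemma transpose_mul_sub_mul_receiverGain {R : Matrix κ τ ℝ} (hR : IsUnit (Rᵀ * R))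
    (Q : Matrix κ ι ℝ) : Rᵀ * (Q - R * receiverGain Q R) = 0 := by
  rw [Matrix.mul_sub, ← Matrix.mul_assoc, receiverGain, Matrix.mul_assoc (Rᵀ * R)⁻¹,
    mul_nonsing_inv_cancel_left _ _ ((isUnit_iff_isUnit_det _).1 hR), sub_self]

variable [Fintype ι] [DecidableEq ι]

omit [Fintype τ] [DecidableEq τ] in
lemma toEuclideanLin_mul_apply [DecidableEq κ] (A : Matrix τ κ ℝ) (B : Matrix κ ι ℝ)
    (v : EuclideanSpace ℝ ι) :
    toEuclideanLin (A * B) v = toEuclideanLin A (toEuclideanLin B v) := by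
  rw [toLpLin_mul 2 2 2, LinearMap.comp_apply]

omit [Fintype κ] in
lemma measurable_toEuclideanLin [Finite κ] (A : Matrix κ ι ℝ) : Measurable (toEuclideanLin A) := by
  cases nonempty_fintype κ
  exact (toEuclideanLin A).toContinuousLinearMap.continuous.measurable

lemma toEuclideanLin_injective {R : Matrix κ τ ℝ} (hR : IsUnit (Rᵀ * R)) :
    Function.Injective (toEuclideanLin R) := by
  classical
  refine Function.LeftInverse.injective (g := toEuclideanLin ((Rᵀ * R)⁻¹ * Rᵀ)) fun u => ?_
  rw [← toEuclideanLin_mul_apply, Matrix.mul_assoc,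
    nonsing_inv_mul _ ((isUnit_iff_isUnit_det _).1 hR), toLpLin_one, LinearMap.id_apply]

lemma inner_toEuclideanLin_eq_zero {A : Matrix κ ι ℝ} {B : Matrix κ τ ℝ}
    (h : Bᵀ * A = 0) (v : EuclideanSpace ℝ ι) (w : EuclideanSpace ℝ τ) :
    inner ℝ (toEuclideanLin A v) (toEuclideanLin B w) = 0 := by
  classical
  rw [← LinearMap.adjoint_inner_left, ← toEuclideanLin_conjTranspose_eq_adjoint,
    conjTranspose_eq_transpose_of_trivial, ← toEuclideanLin_mul_apply, h, map_zero,
    LinearMap.zero_apply, inner_zero_left]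

lemma enorm_add_sq_of_inner_eq_zero {E : Type*} [NormedAddCommGroup E] [InnerProductSpace ℝ E]
    {u v : E} (h : inner ℝ u v = 0) : ‖u + v‖ₑ ^ 2 = ‖u‖ₑ ^ 2 + ‖v‖ₑ ^ 2 := by
  simp only [← ofReal_norm, ← ENNReal.ofReal_pow (norm_nonneg _)]
  rw [← ENNReal.ofReal_add (sq_nonneg _) (sq_nonneg _), norm_add_sq_real, h, mul_zero, add_zero]

lemma enorm_toEuclideanLin_add_sq {R : Matrix κ τ ℝ} (hR : IsUnit (Rᵀ * R))
    (Q : Matrix κ ι ℝ) (v : EuclideanSpace ℝ ι) (u : EuclideanSpace ℝ τ) :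
    ‖toEuclideanLin Q v + toEuclideanLin R u‖ₑ ^ 2 =
      ‖toEuclideanLin (Q - R * receiverGain Q R) v‖ₑ ^ 2 +
        ‖toEuclideanLin R (u + toEuclideanLin (receiverGain Q R) v)‖ₑ ^ 2 := by
  classical
  rw [← enorm_add_sq_of_inner_eq_zero (inner_toEuclideanLin_eq_zero
    (transpose_mul_sub_mul_receiverGain hR Q) _ _), map_sub, LinearMap.sub_apply, map_add,
    toEuclideanLin_mul_apply, add_comm (toEuclideanLin R u), ← add_assoc, sub_add_cancel]

end LeastSquares

section BestResponse

variable {m p q t : ℕ} {Ω : Type*} [MeasurableSpace Ω] {P : Measure Ω}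
  {x : Ω → EuclideanSpace ℝ (Fin p)} {η : Policies m p} {γ : Response m p t}
  {Qr : Matrix (Fin q) (Fin p) ℝ} {Rr : Matrix (Fin q) (Fin t) ℝ}

lemma measurable_posteriorEstimate :
    Measurable[MeasurableSpace.comap (signals x η) inferInstance] (posteriorEstimate P x η) :=
  stronglyMeasurable_condExp.measurable

lemma exists_measurable_response (P : Measure Ω) (x : Ω → EuclideanSpace ℝ (Fin p))
    (η : Policies m p) (K : Matrix (Fin t) (Fin p) ℝ) :
    ∃ γ : Response m p t, Measurable γ ∧
      ∀ ω, γ (signals x η ω) = -toEuclideanLin K (posteriorEstimate P x η ω) := by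
  obtain ⟨g, hg, hcomp⟩ :=
    (measurable_posteriorEstimate (P := P) (x := x) (η := η)).exists_eq_measurable_comp
  refine ⟨fun y => -toEuclideanLin K (g y), ((measurable_toEuclideanLin K).comp hg).neg,
    fun ω => ?_⟩
  rw [hcomp, Function.comp_apply]

variable [IsFiniteMeasure P]

lemma expectedCost_eq_add (hs : Measurable (signals x η)) (hx2 : MemLp x 2 P) (hγ : Measurable γ)
    (Q : Matrix (Fin q) (Fin p) ℝ) (R : Matrix (Fin q) (Fin t) ℝ) :
    expectedCost P x Q R η γ =
      ∫⁻ ω, ‖toEuclideanLin Q ((x - posteriorEstimate P x η) ω)‖ₑ ^ 2 ∂P +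
        ∫⁻ ω, ‖toEuclideanLin Q (posteriorEstimate P x η ω) +
          toEuclideanLin R (γ (signals x η ω))‖ₑ ^ 2 ∂P := by
  have herr : MemLp (x - posteriorEstimate P x η) 2 P := hx2.sub (memLp_posteriorEstimate hx2)
  have hcond := condExp_continuousLinearMap_comp_eq_zero (toEuclideanLin Q).toContinuousLinearMap
    (herr.integrable one_le_two)
    (condExp_sub_condExp_eq_zero hs.comap_le (hx2.integrable one_le_two))
  have hmeas := ((measurable_toEuclideanLin Q).comp (measurable_posteriorEstimate (P := P))).add
    ((measurable_toEuclideanLin R).comp (hγ.comp (comap_measurable (signals x η))))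
  refine Eq.trans ?_ (lintegral_enorm_add_sq_of_condExp_eq_zero hs.comap_le
    (memLp_toEuclideanLin herr Q) hcond hmeas.stronglyMeasurable.aestronglyMeasurable)
  refine lintegral_congr fun ω => ?_
  simp only [Pi.sub_apply, map_sub, ← add_assoc, sub_add_cancel]

lemma receiver_expectedCost_eq_add (hRr : IsUnit (Rrᵀ * Rr)) (hs : Measurable (signals x η))
    (hx2 : MemLp x 2 P) (hγ : Measurable γ) :
    expectedCost P x Qr Rr η γ =
      ∫⁻ ω, ‖toEuclideanLin Qr ((x - posteriorEstimate P x η) ω)‖ₑ ^ 2 ∂P +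
        ∫⁻ ω, ‖toEuclideanLin (Qr - Rr * receiverGain Qr Rr) (posteriorEstimate P x η ω)‖ₑ ^ 2 ∂P +
        ∫⁻ ω, ‖toEuclideanLin Rr (γ (signals x η ω) +
          toEuclideanLin (receiverGain Qr Rr) (posteriorEstimate P x η ω))‖ₑ ^ 2 ∂P := by
  rw [expectedCost_eq_add hs hx2 hγ, add_assoc]
  simp only [enorm_toEuclideanLin_add_sq hRr]
  have hest := memLp_toEuclideanLin (memLp_posteriorEstimate hx2 (η := η))
    (Qr - Rr * receiverGain Qr Rr)
  rw [lintegral_add_left' (hest.aestronglyMeasurable.enorm.pow_const 2)]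

omit [IsFiniteMeasure P] in
lemma lintegral_enorm_sq_eq_zero_iff_response_eq (hRr : IsUnit (Rrᵀ * Rr))
    (hs : Measurable (signals x η)) (hγ : Measurable γ) (K : Matrix (Fin t) (Fin p) ℝ) :
    ∫⁻ ω, ‖toEuclideanLin Rr (γ (signals x η ω) +
        toEuclideanLin K (posteriorEstimate P x η ω))‖ₑ ^ 2 ∂P = 0 ↔
      ∀ᵐ ω ∂P, γ (signals x η ω) = -toEuclideanLin K (posteriorEstimate P x η ω) := by
  have hmeas : Measurable fun ω => toEuclideanLin Rr (γ (signals x η ω) +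
      toEuclideanLin K (posteriorEstimate P x η ω)) :=
    (measurable_toEuclideanLin Rr).comp ((hγ.comp hs).add
      ((measurable_toEuclideanLin K).comp (measurable_posteriorEstimate.mono hs.comap_le le_rfl)))
  rw [lintegral_eq_zero_iff (hmeas.enorm.pow_const 2)]
  refine Filter.eventually_congr (.of_forall fun ω => ?_)
  rw [Pi.zero_apply, pow_eq_zero_iff two_ne_zero, enorm_eq_zero,
    map_eq_zero_iff _ (toEuclideanLin_injective hRr), add_eq_zero_iff_eq_neg]

lemma isBestResponse_iff (hRr : IsUnit (Rrᵀ * Rr)) (hs : Measurable (signals x η))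
    (hx2 : MemLp x 2 P) :
    IsBestResponse P x Qr Rr η γ ↔ Measurable γ ∧ ∀ᵐ ω ∂P, γ (signals x η ω) =
      -toEuclideanLin (receiverGain Qr Rr) (posteriorEstimate P x η ω) := by
  have hest := memLp_posteriorEstimate hx2 (η := η)
  refine and_congr_right fun hγ => ?_
  rw [← lintegral_enorm_sq_eq_zero_iff_response_eq hRr hs hγ]
  refine ⟨fun hmin => ?_, fun hzero γ' hγ' => ?_⟩
  · obtain ⟨γ₀, hγ₀, hval⟩ := exists_measurable_response P x η (receiverGain Qr Rr)
    have hle := hmin γ₀ hγ₀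
    rw [receiver_expectedCost_eq_add hRr hs hx2 hγ, receiver_expectedCost_eq_add hRr hs hx2 hγ₀,
      (lintegral_enorm_sq_eq_zero_iff_response_eq hRr hs hγ₀ _).2 (.of_forall hval),
      lintegral_enorm_toEuclideanLin_sq (hx2.sub hest), lintegral_enorm_toEuclideanLin_sq hest]
      at hle
    exact nonpos_iff_eq_zero.1 ((ENNReal.add_le_add_iff_left
      (ENNReal.add_ne_top.2 ⟨ENNReal.ofReal_ne_top, ENNReal.ofReal_ne_top⟩)).1 hle)
  · rw [receiver_expectedCost_eq_add hRr hs hx2 hγ, receiver_expectedCost_eq_add hRr hs hx2 hγ',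
      hzero]
    exact add_le_add_right zero_le _

lemma exists_isBestResponseMap (hRr : IsUnit (Rrᵀ * Rr)) (hx : Measurable x) (hx2 : MemLp x 2 P) :
    ∃ γ : Policies m p → Response m p t, IsBestResponseMap P x Qr Rr γ := by
  choose γ hγ hval using fun η : Policies m p =>
    exists_measurable_response P x η (receiverGain Qr Rr)
  exact ⟨γ, fun η hη => (isBestResponse_iff hRr (measurable_signals hx hη) hx2).2
    ⟨hγ η, .of_forall (hval η)⟩⟩

lemma IsBestResponse.expectedCost_eq (h : IsBestResponse P x Qr Rr η γ) (hRr : IsUnit (Rrᵀ * Rr))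
    (hs : Measurable (signals x η)) (hx2 : MemLp x 2 P) (Q : Matrix (Fin q) (Fin p) ℝ)
    (R : Matrix (Fin q) (Fin t) ℝ) :
    expectedCost P x Q R η γ = ENNReal.ofReal ((Q * secondMoment P x * Qᵀ).trace +
      (costMatrix Q R Qr Rr * posteriorCov P x η).trace) := by
  obtain ⟨hγ, hae⟩ := (isBestResponse_iff hRr hs hx2).1 h
  have hest := memLp_posteriorEstimate hx2 (η := η)
  have trace_nonneg {y : Ω → EuclideanSpace ℝ (Fin p)} (hy : MemLp y 2 P)
      (A : Matrix (Fin q) (Fin p) ℝ) : 0 ≤ (A * secondMoment P y * Aᵀ).trace := by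
    rw [← secondMoment_toEuclideanLin hy]
    exact (nonneg_iff_posSemidef.1 (secondMoment_nonneg (memLp_toEuclideanLin hy A))).trace_nonneg
  have haction : ∫⁻ ω, ‖toEuclideanLin Q (posteriorEstimate P x η ω) +
        toEuclideanLin R (γ (signals x η ω))‖ₑ ^ 2 ∂P =
      ∫⁻ ω, ‖toEuclideanLin (Q - responseMatrix R Qr Rr) (posteriorEstimate P x η ω)‖ₑ ^ 2 ∂P := by
    refine lintegral_congr_ae ?_
    filter_upwards [hae] with ω hω
    rw [hω, map_neg, ← toEuclideanLin_mul_apply, ← responseMatrix_eq_mul_receiverGain,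
      ← sub_eq_add_neg, map_sub, LinearMap.sub_apply]
  rw [expectedCost_eq_add hs hx2 hγ, haction, lintegral_enorm_toEuclideanLin_sq (hx2.sub hest),
    lintegral_enorm_toEuclideanLin_sq hest,
    ← ENNReal.ofReal_add (trace_nonneg (hx2.sub hest) _) (trace_nonneg hest _),
    secondMoment_sub_posteriorEstimate hs hx2, costMatrix]
  congr 1
  change _ + ((Q - _) * posteriorCov P x η * (Q - _)ᵀ).trace = _
  simp only [Matrix.sub_mul, Matrix.mul_sub, transpose_sub, trace_sub]
  rw [trace_mul_cycle Q (posteriorCov P x η) (responseMatrix R Qr Rr)ᵀ,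
    trace_mul_cycle (responseMatrix R Qr Rr) (posteriorCov P x η) Qᵀ,
    trace_mul_cycle (responseMatrix R Qr Rr) (posteriorCov P x η) (responseMatrix R Qr Rr)ᵀ]
  ring

end BestResponse

section Gaussian

variable {ι κ τ Ω : Type*} [Fintype ι] [DecidableEq ι] [MeasurableSpace Ω] {P : Measure Ω}
  {x : Ω → EuclideanSpace ℝ ι} {μ : EuclideanSpace ℝ ι} {Sx : Matrix ι ι ℝ}

lemma hasGaussianLaw_of_map_eq (hlaw : P.map x = multivariateGaussian μ Sx) :
    HasGaussianLaw x P :=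
  ⟨by rw [hlaw]; infer_instance⟩

lemma integral_eq_of_map_eq (hlaw : P.map x = multivariateGaussian μ Sx) :
    ∫ ω, x ω ∂P = μ := by
  rw [← integral_map (f := fun v => v) (hasGaussianLaw_of_map_eq hlaw).aemeasurable (by fun_prop),
    hlaw, integral_id_multivariateGaussian]

lemma integral_toEuclideanLin_eq [Fintype κ] (hlaw : P.map x = multivariateGaussian μ Sx)
    (A : Matrix κ ι ℝ) : ∫ ω, toEuclideanLin A (x ω) ∂P = toEuclideanLin A μ :=
  ((toEuclideanLin A).toContinuousLinearMap.integral_comp_comm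
    (hasGaussianLaw_of_map_eq hlaw).integrable).trans
      (congrArg (toEuclideanLin A) (integral_eq_of_map_eq hlaw))

variable [IsProbabilityMeasure P]

lemma secondMoment_eq_of_map_eq (hSx : Sx.PosSemidef)
    (hlaw : P.map x = multivariateGaussian 0 Sx) : secondMoment P x = Sx := by
  have hG := hasGaussianLaw_of_map_eq hlaw
  ext a b
  have hmean (c : ι) : ∫ ω, x ω c ∂P = 0 :=
    ((PiLp.proj 2 (𝕜 := ℝ) (fun _ : ι => ℝ) c).integral_comp_comm hG.integrable).trans
      (congrArg (PiLp.proj 2 (𝕜 := ℝ) (fun _ : ι => ℝ) c) (integral_eq_of_map_eq hlaw))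
  rw [← covariance_eval_multivariateGaussian (μ := 0) hSx a b, ← hlaw,
    covariance_map_fun (by fun_prop) (by fun_prop) hG.aemeasurable,
    covariance_eq_sub (memLp_apply hG.memLp_two a) (memLp_apply hG.memLp_two b), hmean, zero_mul,
    sub_zero]
  rfl

omit [IsProbabilityMeasure P] in
lemma covariance_inner_toEuclideanLin [Fintype κ] [Fintype τ] (hSx : Sx.PosSemidef)
    (hlaw : P.map x = multivariateGaussian μ Sx) (A : Matrix κ ι ℝ) (B : Matrix τ ι ℝ)
    (u : EuclideanSpace ℝ κ) (v : EuclideanSpace ℝ τ) :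
    cov[fun ω => inner ℝ u (toEuclideanLin A (x ω)), fun ω => inner ℝ v (toEuclideanLin B (x ω)); P]
      = u ⬝ᵥ (A * Sx * Bᵀ) *ᵥ v := by
  classical
  simp only [← LinearMap.adjoint_inner_left, ← toEuclideanLin_conjTranspose_eq_adjoint,
    conjTranspose_eq_transpose_of_trivial]
  have hid : MemLp id 2 (multivariateGaussian μ Sx) := IsGaussian.memLp_two_id
  rw [← covariance_map_fun (μ := P) (Z := x) (X := fun w => inner ℝ (toEuclideanLin Aᵀ u) w)
      (Y := fun w => inner ℝ (toEuclideanLin Bᵀ v) w) (by fun_prop) (by fun_prop)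
      (hasGaussianLaw_of_map_eq hlaw).aemeasurable, hlaw, ← covarianceBilin_apply_eq_cov hid,
    covarianceBilin_multivariateGaussian hSx]
  simp only [ofLp_toLpLin, toLin'_apply, mulVec_transpose, ← mulVec_mulVec, dotProduct_mulVec]

omit [IsProbabilityMeasure P] in
lemma indepFun_toEuclideanLin [Finite κ] [Finite τ] (hSx : Sx.PosSemidef)
    (hlaw : P.map x = multivariateGaussian μ Sx) {A : Matrix κ ι ℝ} {B : Matrix τ ι ℝ}
    (h : A * Sx * Bᵀ = 0) :
    IndepFun (fun ω => toEuclideanLin A (x ω)) (fun ω => toEuclideanLin B (x ω)) P := by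
  cases nonempty_fintype κ
  cases nonempty_fintype τ
  have hjoint : HasGaussianLaw (fun ω => (toEuclideanLin A (x ω), toEuclideanLin B (x ω))) P :=
    (hasGaussianLaw_of_map_eq hlaw).map_fun ((toEuclideanLin A).toContinuousLinearMap.prod
      (toEuclideanLin B).toContinuousLinearMap)
  refine hjoint.indepFun_of_covariance_inner fun u v => ?_
  rw [covariance_inner_toEuclideanLin hSx hlaw, h, zero_mulVec, dotProduct_zero]

end Gaussian

section LinearPolicy

variable {m p : ℕ} {Ω : Type*} [MeasurableSpace Ω] {P : Measure Ω} [IsProbabilityMeasure P]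
  {x : Ω → EuclideanSpace ℝ (Fin p)} {Sx S U L K : Matrix (Fin p) (Fin p) ℝ} {d : Fin p → ℝ}

omit [MeasurableSpace Ω] in
lemma measurable_toEuclideanLin_mul_comap_signals (x : Ω → EuclideanSpace ℝ (Fin p))
    (hm : IsEmpty (Fin m) → K * L = 0) :
    Measurable[MeasurableSpace.comap (signals x fun _ : Fin m => toEuclideanLin L) inferInstance]
      fun ω => toEuclideanLin (K * L) (x ω) := by
  rcases isEmpty_or_nonempty (Fin m) with h | ⟨⟨i⟩⟩
  · rw [hm h, map_zero]
    exact measurable_const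
  · simp only [toEuclideanLin_mul_apply]
    have hi : Measurable fun y : Fin m → EuclideanSpace ℝ (Fin p) => toEuclideanLin K (y i) :=
      (measurable_toEuclideanLin K).comp (measurable_pi_apply i)
    exact Measurable.comp (f := signals x fun _ => toEuclideanLin L) hi (comap_measurable _)

lemma posteriorEstimate_toEuclideanLin (hSx : Sx.PosSemidef) (hx : Measurable x)
    (hlaw : P.map x = multivariateGaussian 0 Sx) (hm : IsEmpty (Fin m) → K * L = 0)
    (horth : L * Sx * (1 - K * L)ᵀ = 0) :
    posteriorEstimate P x (fun _ : Fin m => toEuclideanLin L) =ᵐ[P]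
      fun ω => toEuclideanLin (K * L) (x ω) := by
  have hx2 := (hasGaussianLaw_of_map_eq hlaw).memLp_two
  have integrable_image (A : Matrix (Fin p) (Fin p) ℝ) :
      Integrable (fun ω => toEuclideanLin A (x ω)) P :=
    (memLp_toEuclideanLin hx2 A).integrable one_le_two
  have hindep : IndepFun (fun ω => toEuclideanLin (1 - K * L) (x ω))
      (signals x fun _ : Fin m => toEuclideanLin L) P :=
    (indepFun_toEuclideanLin hSx hlaw horth).symm.comp measurable_id
      (measurable_pi_lambda (fun (y : EuclideanSpace ℝ (Fin p)) (_ : Fin m) => y)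
        fun _ => measurable_id)
  have hsplit : x = (fun ω => toEuclideanLin (K * L) (x ω)) +
      fun ω => toEuclideanLin (1 - K * L) (x ω) := by
    ext1 ω
    rw [Pi.add_apply, ← LinearMap.add_apply, ← map_add, add_sub_cancel, toLpLin_one,
      LinearMap.id_apply]
  have hmean : ∫ ω, toEuclideanLin (1 - K * L) (x ω) ∂P = 0 :=
    (integral_toEuclideanLin_eq hlaw _).trans (map_zero _)
  have h := condExp_add_of_indep ((measurable_toEuclideanLin (1 - K * L)).comp hx).comap_le
    (measurable_signals hx fun _ => measurable_toEuclideanLin L).comap_le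
    (integrable_image (K * L)) (measurable_toEuclideanLin_mul_comap_signals x hm).stronglyMeasurable
    (integrable_image (1 - K * L)) (comap_measurable _).stronglyMeasurable hmean hindep
  rwa [← hsplit] at h

lemma posteriorCov_toEuclideanLin (hSx : Sx.PosSemidef) (hx : Measurable x)
    (hlaw : P.map x = multivariateGaussian 0 Sx) (hm : IsEmpty (Fin m) → K * L = 0)
    (horth : L * Sx * (1 - K * L)ᵀ = 0) :
    posteriorCov P x (fun _ : Fin m => toEuclideanLin L) = K * L * Sx := by
  calc posteriorCov P x (fun _ : Fin m => toEuclideanLin L)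
      = secondMoment P (fun ω => toEuclideanLin (K * L) (x ω)) :=
        secondMoment_congr (posteriorEstimate_toEuclideanLin hSx hx hlaw hm horth)
    _ = K * (L * Sx * (K * L)ᵀ) := by
        rw [secondMoment_toEuclideanLin (hasGaussianLaw_of_map_eq hlaw).memLp_two,
          secondMoment_eq_of_map_eq hSx hlaw]
        simp only [Matrix.mul_assoc]
    _ = K * L * Sx := by
        rw [transpose_sub, transpose_one, Matrix.mul_sub, Matrix.mul_one, sub_eq_zero] at horth
        rw [← horth, Matrix.mul_assoc]

lemma eq_transpose_mul_whiten_mul_inv_sqrt (hU : U ∈ Matrix.orthogonalGroup (Fin p) ℝ)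
    (hd : whiten Sx S = U * diagonal d * Uᵀ) (hL : Lᵀ = (CFC.sqrt Sx)⁻¹ * U * diagonal d) :
    L = Uᵀ * whiten Sx S * (CFC.sqrt Sx)⁻¹ := by
  have hUU : Uᵀ * U = 1 := (mem_orthogonalGroup_iff' _ _).1 hU
  have hC : ((CFC.sqrt Sx)⁻¹)ᵀ = (CFC.sqrt Sx)⁻¹ := isSelfAdjoint_inv_sqrt
  rw [← transpose_transpose L, hL, transpose_mul, transpose_mul, hC, diagonal_transpose, hd,
    ← Matrix.mul_assoc, ← Matrix.mul_assoc, ← Matrix.mul_assoc, hUU, Matrix.one_mul]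

lemma sqrt_mul_mul_eq (hU : U ∈ Matrix.orthogonalGroup (Fin p) ℝ)
    (hL : L = Uᵀ * whiten Sx S * (CFC.sqrt Sx)⁻¹) :
    CFC.sqrt Sx * U * L = CFC.sqrt Sx * whiten Sx S * (CFC.sqrt Sx)⁻¹ := by
  have hUU : U * Uᵀ = 1 := (mem_orthogonalGroup_iff _ _).1 hU
  rw [hL, Matrix.mul_assoc (CFC.sqrt Sx), ← Matrix.mul_assoc U, ← Matrix.mul_assoc U, hUU,
    Matrix.one_mul, ← Matrix.mul_assoc]

lemma mul_mul_one_sub_transpose_eq_zero (hSx : Sx.PosDef) (hP : IsStarProjection (whiten Sx S))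
    (hU : U ∈ Matrix.orthogonalGroup (Fin p) ℝ) (hL : L = Uᵀ * whiten Sx S * (CFC.sqrt Sx)⁻¹) :
    L * Sx * (1 - CFC.sqrt Sx * U * L)ᵀ = 0 := by
  have hW : (whiten Sx S)ᵀ = whiten Sx S := hP.isSelfAdjoint
  have hC : (CFC.sqrt Sx)ᵀ = CFC.sqrt Sx := isSelfAdjoint_sqrt
  have hCinv : ((CFC.sqrt Sx)⁻¹)ᵀ = (CFC.sqrt Sx)⁻¹ := isSelfAdjoint_inv_sqrt
  rw [transpose_sub, transpose_one, Matrix.mul_sub, Matrix.mul_one, sub_eq_zero,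
    sqrt_mul_mul_eq hU hL, hL, Matrix.mul_assoc _ _ Sx, inv_sqrt_mul_self hSx, transpose_mul,
    transpose_mul, hW, hC, hCinv]
  calc Uᵀ * whiten Sx S * CFC.sqrt Sx
      = Uᵀ * (whiten Sx S * whiten Sx S) * CFC.sqrt Sx := by rw [hP.isIdempotentElem.eq]
    _ = Uᵀ * whiten Sx S * (CFC.sqrt Sx * (CFC.sqrt Sx)⁻¹) * (whiten Sx S * CFC.sqrt Sx) := by
        rw [mul_nonsing_inv _ (isUnit_det_sqrt hSx)]
        simp only [Matrix.mul_assoc, Matrix.one_mul]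
    _ = Uᵀ * whiten Sx S * CFC.sqrt Sx * ((CFC.sqrt Sx)⁻¹ * (whiten Sx S * CFC.sqrt Sx)) := by
        simp only [Matrix.mul_assoc]

lemma posteriorCov_of_isStarProjection_whiten (hSx : Sx.PosDef) (hx : Measurable x)
    (hlaw : P.map x = multivariateGaussian 0 Sx) (hm : IsEmpty (Fin m) → S = 0)
    (hP : IsStarProjection (whiten Sx S)) (hU : U ∈ Matrix.orthogonalGroup (Fin p) ℝ)
    (hd : whiten Sx S = U * diagonal d * Uᵀ) (hL : Lᵀ = (CFC.sqrt Sx)⁻¹ * U * diagonal d) :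
    posteriorCov P x (fun _ : Fin m => toEuclideanLin L) = S := by
  have hLW := eq_transpose_mul_whiten_mul_inv_sqrt hU hd hL
  have hzero (h : IsEmpty (Fin m)) : CFC.sqrt Sx * U * L = 0 := by
    rw [sqrt_mul_mul_eq hU hLW, hm h, whiten_zero, Matrix.mul_zero, Matrix.zero_mul]
  rw [posteriorCov_toEuclideanLin hSx.posSemidef hx hlaw hzero
    (mul_mul_one_sub_transpose_eq_zero hSx hP hU hLW), sqrt_mul_mul_eq hU hLW,
    Matrix.mul_assoc _ _ Sx, inv_sqrt_mul_self hSx, sqrt_mul_whiten_mul_sqrt hSx]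

end LinearPolicy

section Nash

variable {m p q t : ℕ} {Ω : Type*} [MeasurableSpace Ω] {P : Measure Ω} [IsFiniteMeasure P]
  {x : Ω → EuclideanSpace ℝ (Fin p)} {Q : Fin m → Matrix (Fin q) (Fin p) ℝ}
  {R : Fin m → Matrix (Fin q) (Fin t) ℝ} {Qr : Matrix (Fin q) (Fin p) ℝ}
  {Rr : Matrix (Fin q) (Fin t) ℝ}

lemma isNashPolicies_of_trace_le (hRr : IsUnit (Rrᵀ * Rr)) (hx : Measurable x) (hx2 : MemLp x 2 P)
    {η : Policies m p} (hη : ∀ i, Measurable (η i))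
    (h : ∀ i η', Measurable η' → (costMatrix (Q i) (R i) Qr Rr * posteriorCov P x η).trace ≤
      (costMatrix (Q i) (R i) Qr Rr * posteriorCov P x (Function.update η i η')).trace) :
    IsNashPolicies P x Q R Qr Rr η := by
  refine ⟨exists_isBestResponseMap hRr hx hx2, fun γ hγ => ⟨hη, hγ, fun i η' hη' => ?_⟩⟩
  have hupdate : ∀ j, Measurable (Function.update η i η' j) :=
    (Function.forall_update_iff η fun _ f => Measurable f).2 ⟨hη', fun j _ => hη j⟩
  rw [(hγ η hη).expectedCost_eq hRr (measurable_signals hx hη) hx2,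
    (hγ _ hupdate).expectedCost_eq hRr (measurable_signals hx hupdate) hx2]
  exact ENNReal.ofReal_le_ofReal (add_le_add_right (h i η' hη') _)

lemma isNashPolicies_const (hRr : IsUnit (Rrᵀ * Rr)) (hx : Measurable x) (hx2 : MemLp x 2 P)
    {f : EuclideanSpace ℝ (Fin p) → EuclideanSpace ℝ (Fin p)} (hf : Measurable f)
    (hstable : ∀ i, IsStable (secondMoment P x) (costMatrix (Q i) (R i) Qr Rr)
      (posteriorCov P x fun _ : Fin m => f))
    (hsingle : Subsingleton (Fin m) → ∀ i, ∀ T ∈ feasible (secondMoment P x) 0,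
      (costMatrix (Q i) (R i) Qr Rr * posteriorCov P x fun _ : Fin m => f).trace ≤
        (costMatrix (Q i) (R i) Qr Rr * T).trace) :
    IsNashPolicies P x Q R Qr Rr fun _ => f := by
  refine isNashPolicies_of_trace_le hRr hx hx2 (fun _ => hf) fun i η' hη' => ?_
  have hupdate : Measurable (signals x (Function.update (fun _ : Fin m => f) i η')) :=
    measurable_signals hx <|
      (Function.forall_update_iff _ fun _ g => Measurable g).2 ⟨hη', fun _ _ => hf⟩
  have hmem := posteriorCov_mem_feasible hupdate hx2
  rcases subsingleton_or_nontrivial (Fin m) with hm | hm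
  · exact hsingle hm i _ hmem
  · obtain ⟨j, hj⟩ := exists_ne i
    have hle := posteriorCov_mono hupdate hx2
      (comap_signals_const_le j (Function.update_of_ne hj _ _))
    exact (hstable i).2 _ ⟨hmem.1, le_iff.1 hle, hmem.2.2⟩

end Nash

end StrategicCommunication

end

open StrategicCommunication in
theorem theorem3 {m p q t : ℕ} {Ω : Type*} [MeasurableSpace Ω]
    (P : Measure Ω) [IsProbabilityMeasure P]
    (Sx : Matrix (Fin p) (Fin p) ℝ) (hSx : Sx.PosDef)
    (x : Ω → EuclideanSpace ℝ (Fin p)) (hx : Measurable x)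
    (hlaw : P.map x = multivariateGaussian 0 Sx)
    (Q : Fin m → Matrix (Fin q) (Fin p) ℝ) (R : Fin m → Matrix (Fin q) (Fin t) ℝ)
    (Qr : Matrix (Fin q) (Fin p) ℝ) (Rr : Matrix (Fin q) (Fin t) ℝ)
    (hRr : IsUnit (Rrᵀ * Rr))
    (N : Equiv.Perm (Fin m)) (S : Matrix (Fin p) (Fin p) ℝ)
    (hS : StrategicCommunication.IsAlgorithmOutput Sx
      (fun i => StrategicCommunication.costMatrix (Q i) (R i) Qr Rr) N S) :
    (∀ i, StrategicCommunication.IsStable Sx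
      (StrategicCommunication.costMatrix (Q i) (R i) Qr Rr) S) ∧
    IsStarProjection (StrategicCommunication.whiten Sx S) ∧
    S = CFC.sqrt Sx * StrategicCommunication.whiten Sx S * CFC.sqrt Sx ∧
    ∀ (U : Matrix (Fin p) (Fin p) ℝ) (d : Fin p → ℝ) (L : Matrix (Fin p) (Fin p) ℝ),
      U ∈ Matrix.orthogonalGroup (Fin p) ℝ →
      StrategicCommunication.whiten Sx S = U * Matrix.diagonal d * Uᵀ →
      Lᵀ = (CFC.sqrt Sx)⁻¹ * U * Matrix.diagonal d →
      StrategicCommunication.IsNashPolicies P x Q R Qr Rr (fun _ => toEuclideanLin L) ∧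
      StrategicCommunication.posteriorCov P x (fun _ : Fin m => toEuclideanLin L) = S := by
  have hstable := hS.isStable
  have hP := hS.isStarProjection_whiten hSx
  refine ⟨hstable, hP, (sqrt_mul_whiten_mul_sqrt hSx S).symm, fun U d L hU hd hL => ?_⟩
  have hx2 := (hasGaussianLaw_of_map_eq hlaw).memLp_two
  have hmoment := secondMoment_eq_of_map_eq hSx.posSemidef hlaw
  have hpost := posteriorCov_of_isStarProjection_whiten (m := m) hSx hx hlaw
    (fun hm => hS.eq_zero_of_isEmpty) hP hU hd hL
  refine ⟨isNashPolicies_const hRr hx hx2 (measurable_toEuclideanLin L) ?_ ?_, hpost⟩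
  · rwa [hmoment, hpost]
  · rw [hmoment, hpost]
    exact fun hm i T hT => hS.trace_le_of_subsingleton i hT
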